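/- For a compact set $K\subset\mathbb{C}$, let $\mathcal{P}(K)$ be the set of Borel probability measures on $K$, let $$V_K=\inf_{\mu\in\mathcal{P}(K)}\iint\log\frac{1}{|z-t|}\,d\mu(z)\,d\mu(t)\in(-\infty,+\infty],$$ and let $\mathrm{cap}(K)=e^{-V_K}$ (so $\mathrm{cap}(K)=0$ if $V_K=+\infty$) be the logarithmic capacity of $K$. Theorem (Hilbert's lemniscate theorem). Let $K\subset\mathbb{C}$ be a compact set with $\mathrm{cap}(K)>0$, and let $U\supset K$ be an open set such that $\mathbb{C}\setminus U$ is connected. Assume moreover that $U=\mathbb{C}$ or that $\mathbb{C}\setminus U$ meets the unbounded connected component of $\mathbb{C}\setminus K$ (that is, $\mathbb{C}\setminus U$ is not contained in a bounded component of $\mathbb{C}\setminus K$; this holds automatically if $U$ is bounded or $\mathbb{C}\setminus U$ is unbounded). Then there exist a monic polynomial $p\in\mathbb{C}[X]$ of degree $d>0$ and a real constant $\rho>\mathrm{cap}(K)$ such that $$K\subset\{z\in\mathbb{C}: |p(z)|\le\rho^d\}\subset U.$$ -/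

import Mathlib

open MeasureTheory Polynomial
open scoped ENNReal

noncomputable section

/-- The integral `∫ f⁺ dν - ∫ f⁻ dν` of an extended-real-valued function. It is meaningful when one
of the two terms is finite; for the logarithmic kernel and a probability measure carried by a
compact set the negative part is bounded, so the integral has a value in `(-∞, +∞]`. -/
def extendedIntegral {X : Type*} [MeasurableSpace X] (ν : Measure X) (f : X → EReal) : EReal :=
  ((∫⁻ x, (f x).toENNReal ∂ν : ℝ≥0∞) : EReal) - ((∫⁻ x, (-f x).toENNReal ∂ν : ℝ≥0∞) : EReal)

/-- The logarithmic kernel `log (1 / |z - t|)`, equal to `+∞` on the diagonal. -/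
def logKernel (z t : ℂ) : EReal := -ENNReal.log ‖z - t‖ₑ

/-- The logarithmic energy `I(μ) = ∬ log (1 / |z - t|) dμ(z) dμ(t)`. -/
def logEnergy (μ : Measure ℂ) : EReal :=
  extendedIntegral (μ.prod μ) (fun w => logKernel w.1 w.2)

/-- The Robin constant `V_K`: the infimum of `I(μ)` over the Borel probability measures `μ` on `K`,
seen as probability measures on `ℂ` carried by `K`. It is `+∞` if `K` is empty. -/
def robinConstant (K : Set ℂ) : EReal :=
  ⨅ (μ : ProbabilityMeasure ℂ) (_ : (μ : Measure ℂ) Kᶜ = 0), logEnergy (μ : Measure ℂ)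

/-- The logarithmic capacity `cap(K) = exp (-V_K)` of a compact set `K`. -/
def logCapacity (K : Set ℂ) : ℝ≥0∞ := EReal.exp (-robinConstant K)

/-- The unbounded connected component `Ω_K` of `ℂ ∖ K`, for `K` compact. -/
def unboundedComponent (K : Set ℂ) : Set ℂ :=
  {z | z ∉ K ∧ ¬ Bornology.IsBounded (connectedComponentIn Kᶜ z)}

/-- The lemniscate `L_{p,ρ} = {z : |p(z)| ≤ ρ ^ d}`, where `d` is the degree of `p`. -/
def lemniscate (p : ℂ[X]) (ρ : ℝ) : Set ℂ := {z | ‖p.eval z‖ ≤ ρ ^ p.natDegree}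

end

/-! Passing from `C(K, ℂ)` to the closed algebra generated by the polynomials only fills holes of
the spectrum `K` of the coordinate. So `z - x` stays invertible there for `z` in the unbounded
component, and approximating its inverse by polynomials separates `z` from `K`. By compactness,
finitely many `q` with `|q| ≤ 1` on `K` suffice for all of `ℂ ∖ U`.

A single Fekete polynomial `p` replaces this family (`exists_monic_separating`). Interpolating `q ^
k` at `N` Fekete points bounds `|q(z)| ^ k |p(x)|` by a constant times `N |p(z)|`. The left side
grows exponentially in `k`, while `N` need only grow linearly, so `|p(z)| ≥ 2 |p(x)|` for large `k`.
With `M = max |p|` on `K`, the level `3M/2` then gives the lemniscate.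

For the capacity (`logCapacity_le_of_norm_eval_le`), a Vandermonde determinant on `K` is estimated
in the basis `p ^ a * X ^ b`. Averaging its logarithm over independent points of law `μ` bounds the
energy of `μ` below, so `cap K ≤ M ^ (1/d) < ρ`. -/

/-! ### Separation by several polynomials -/

/-- A point of the unbounded component of `ℂ ∖ K` is separated from `K` by a polynomial. -/
theorem exists_polynomial_separating {K : Set ℂ} (hK : IsCompact K) {z : ℂ}
    (hz : z ∈ unboundedComponent K) :
    ∃ q : ℂ[X], q.eval z = 2 ∧ ∀ x ∈ K, ‖q.eval x‖ ≤ 1 := by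
  obtain ⟨hzK, hzb⟩ := hz
  have : CompactSpace K := isCompact_iff_compactSpace.mp hK
  let S : Subalgebra ℂ C(K, ℂ) := (polynomialFunctions K).topologicalClosure
  have hS : IsClosed (S : Set C(K, ℂ)) := Subalgebra.isClosed_topologicalClosure _
  have hXS : toContinuousMapOn (X : ℂ[X]) K ∈ S :=
    Subalgebra.le_topologicalClosure _ ⟨X, trivial, rfl⟩
  let x : S := ⟨toContinuousMapOn X K, hXS⟩
  have hspec : spectrum ℂ (x : C(K, ℂ)) = K := by
    rw [ContinuousMap.spectrum_eq_range]
    ext w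
    simp [x]
  have hnot : z ∉ spectrum ℂ x := by
    intro h
    have := Subalgebra.spectrum_isBounded_connectedComponentIn S x h
    rw [hspec] at this
    exact hzb this
  rw [spectrum.notMem_iff] at hnot
  obtain ⟨y, hy⟩ := hnot.exists_right_inv
  have hyc : (y : C(K, ℂ)) ∈ closure (polynomialFunctions K : Set C(K, ℂ)) := y.2
  obtain ⟨R, hR0, hR⟩ : ∃ R : ℝ, 0 < R ∧ ∀ x ∈ K, ‖z - x‖ ≤ R := by
    obtain ⟨R, hR⟩ := hK.exists_bound_of_continuousOn (f := fun x => z - x) (by fun_prop)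
    exact ⟨max R 1, by positivity, fun x hx => (hR x hx).trans (le_max_left _ _)⟩
  -- On `K`, `1 - (z - t) p(t)` is `z - t` times the error of `p` as an approximate inverse, hence
  -- at most `1/2` at this tolerance; at `z` it equals `1`.
  obtain ⟨_, ⟨p, -, rfl⟩, hp⟩ := Metric.mem_closure_iff.mp hyc (1 / (2 * R)) (by positivity)
  refine ⟨2 * (1 - (C z - X) * p), by simp, fun t ht => ?_⟩
  have h1 : (z - t) * (y : C(K, ℂ)) ⟨t, ht⟩ = 1 := by
    have := congrArg (fun f : S => (f : C(K, ℂ)) ⟨t, ht⟩) hy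
    simpa [x] using this
  have h2 : ‖(y : C(K, ℂ)) ⟨t, ht⟩ - p.eval t‖ ≤ 1 / (2 * R) := by
    have := (ContinuousMap.dist_apply_le_dist (f := (y : C(K, ℂ)))
      (g := toContinuousMapOnAlgHom K p) ⟨t, ht⟩).trans hp.le
    simpa [dist_eq_norm] using this
  have h3 : (2 * (1 - (C z - X) * p)).eval t
      = 2 * ((z - t) * ((y : C(K, ℂ)) ⟨t, ht⟩ - p.eval t)) := by
    rw [mul_sub (z - t), h1]; simp
  rw [h3, norm_mul, norm_mul, Complex.norm_ofNat]
  calc 2 * (‖z - t‖ * ‖(y : C(K, ℂ)) ⟨t, ht⟩ - p.eval t‖) ≤ 2 * (R * (1 / (2 * R))) := by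
        gcongr; exact hR t ht
    _ = 1 := by field_simp

/-- A closed subset of the unbounded component of `ℂ ∖ K` is separated from `K` by finitely many
polynomials. -/
theorem exists_finset_polynomial_separating {K F : Set ℂ} (hK : IsCompact K) (hF : IsClosed F)
    (hFK : F ⊆ unboundedComponent K) :
    ∃ Q : Finset ℂ[X], (∀ q ∈ Q, ∀ x ∈ K, ‖q.eval x‖ ≤ 1) ∧
      ∀ z ∈ F, ∃ q ∈ Q, 3 / 2 ≤ ‖q.eval z‖ := by
  classical
  choose! q hq2 hq1 using fun z (hz : z ∈ F) => exists_polynomial_separating hK (hFK hz)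
  obtain ⟨R, hR0, hR⟩ : ∃ R : ℝ, 0 < R ∧ ∀ x ∈ K, ‖x‖ ≤ R := by
    obtain ⟨R, hR⟩ := hK.exists_bound_of_continuousOn (f := fun x => x) (by fun_prop)
    exact ⟨max R 1, by positivity, fun x hx => (hR x hx).trans (le_max_left _ _)⟩
  have hc : IsCompact (F ∩ Metric.closedBall 0 (3 / 2 * R)) :=
    (isCompact_closedBall _ _).inter_left hF
  obtain ⟨t, ht, hcov⟩ := hc.elim_nhds_subcover (fun z => {w | 3 / 2 < ‖(q z).eval w‖})
    (fun z hz => by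
      have : IsOpen {w | 3 / 2 < ‖(q z).eval w‖} :=
        isOpen_lt continuous_const (q z).continuous.norm
      refine this.mem_nhds ?_
      simp only [Set.mem_ofPred_eq, hq2 z hz.1, Complex.norm_ofNat]
      norm_num)
  -- `F` may be unbounded: the linear polynomial `X / R` takes care of the points outside the ball
  -- of radius `3R/2`.
  refine ⟨insert (C (R⁻¹ : ℂ) * X) (t.image q), ?_, fun z hz => ?_⟩
  · intro p hp x hx
    rcases Finset.mem_insert.mp hp with rfl | hp
    · have := hR x hx
      simp only [eval_mul, eval_C, eval_X, norm_mul, norm_inv, Complex.norm_real,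
        Real.norm_of_nonneg hR0.le]
      rw [inv_mul_le_iff₀ hR0]; linarith
    · obtain ⟨w, hw, rfl⟩ := Finset.mem_image.mp hp
      exact hq1 w (ht w hw).1 x hx
  · by_cases hzR : ‖z‖ ≤ 3 / 2 * R
    · have hz' := hcov ⟨hz, by simpa using hzR⟩
      simp only [Set.mem_iUnion] at hz'
      obtain ⟨w, hw, h⟩ := hz'
      exact ⟨q w, Finset.mem_insert_of_mem (Finset.mem_image_of_mem _ hw), le_of_lt h⟩
    · refine ⟨_, Finset.mem_insert_self _ _, ?_⟩
      simp only [eval_mul, eval_C, eval_X, norm_mul, norm_inv, Complex.norm_real,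
        Real.norm_of_nonneg hR0.le]
      rw [le_inv_mul_iff₀ hR0]; linarith

/-! ### Fekete points and a single separating polynomial -/

/-- Existence of Fekete points: a point of an `N`-tuple maximizing the product of the mutual
distances maximizes the product of the distances to the other points. -/
theorem exists_fekete_points {K : Set ℂ} (hK : IsCompact K) (hinf : K.Infinite) (N : ℕ) :
    ∃ v : Fin N → ℂ, (∀ i, v i ∈ K) ∧ Function.Injective v ∧
      ∀ i, ∀ x ∈ K, ∏ j ∈ Finset.univ.erase i, ‖x - v j‖
        ≤ ∏ j ∈ Finset.univ.erase i, ‖v i - v j‖ := by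
  classical
  let G : (Fin N → ℂ) → ℝ := fun v => ∏ k, ∏ j ∈ Finset.univ.erase k, ‖v k - v j‖
  have hG : Continuous G := by fun_prop
  have : Infinite K := hinf.to_subtype
  let e : Fin N ↪ K := Fin.valEmbedding.trans (Infinite.natEmbedding K)
  have hpos : ∀ v : Fin N → ℂ, Function.Injective v → 0 < G v := fun v hv =>
    Finset.prod_pos fun k _ => Finset.prod_pos fun j hj =>
      norm_pos_iff.mpr (sub_ne_zero.mpr (hv.ne (Finset.ne_of_mem_erase hj).symm))
  have hcomp : IsCompact (Set.univ.pi fun _ : Fin N => K) := isCompact_univ_pi fun _ => hK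
  obtain ⟨v, hvK, hmax⟩ := hcomp.exists_isMaxOn
    ⟨fun i => (e i : ℂ), fun i _ => (e i).2⟩ hG.continuousOn
  have hvK' : ∀ i, v i ∈ K := fun i => hvK i trivial
  have hGv : 0 < G v := (hpos (fun i => (e i : ℂ))
    (Subtype.val_injective.comp e.injective)).trans_le (hmax fun i _ => (e i).2)
  have hinj : Function.Injective v := by
    intro a b hab
    by_contra hne
    refine hGv.ne' (Finset.prod_eq_zero (Finset.mem_univ a) (Finset.prod_eq_zero
      (Finset.mem_erase.mpr ⟨Ne.symm hne, Finset.mem_univ b⟩) ?_))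
    simp [hab]
  refine ⟨v, hvK', hinj, fun i x hx => ?_⟩
  -- `G` runs over ordered pairs, so the distances from the moved point `y` appear twice, whence the
  -- square.
  have hsplit : ∀ y : ℂ, G (Function.update v i y) =
      (∏ j ∈ Finset.univ.erase i, ‖y - v j‖) ^ 2 *
        ∏ k ∈ Finset.univ.erase i, ∏ j ∈ (Finset.univ.erase k).erase i, ‖v k - v j‖ := by
    intro y
    have h1 : ∏ j ∈ Finset.univ.erase i, ‖Function.update v i y i - Function.update v i y j‖
        = ∏ j ∈ Finset.univ.erase i, ‖y - v j‖ :=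
      Finset.prod_congr rfl fun j hj => by
        rw [Function.update_self, Function.update_of_ne (Finset.ne_of_mem_erase hj)]
    have h2 : ∀ k ∈ Finset.univ.erase i,
        ∏ j ∈ Finset.univ.erase k, ‖Function.update v i y k - Function.update v i y j‖
          = ‖y - v k‖ * ∏ j ∈ (Finset.univ.erase k).erase i, ‖v k - v j‖ := by
      intro k hk
      have hki := Finset.ne_of_mem_erase hk
      rw [← Finset.mul_prod_erase _ _ (Finset.mem_erase.mpr ⟨hki.symm, Finset.mem_univ i⟩),
        Function.update_self, Function.update_of_ne hki, norm_sub_rev]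
      congr 1
      exact Finset.prod_congr rfl fun j hj => by
        rw [Function.update_of_ne (Finset.ne_of_mem_erase hj)]
    change ∏ k, _ = _
    rw [← Finset.mul_prod_erase _ _ (Finset.mem_univ i), h1, Finset.prod_congr rfl h2,
      Finset.prod_mul_distrib]
    ring
  have hle : G (Function.update v i x) ≤ G v := by
    refine hmax fun j _ => ?_
    by_cases h : j = i
    · subst h; simpa using hx
    · simpa [Function.update_of_ne h] using hvK' j
  have hself : G v = _ := (congrArg G (Function.update_eq_self i v)).symm.trans (hsplit (v i))
  have hP : 0 < ∏ k ∈ Finset.univ.erase i, ∏ j ∈ (Finset.univ.erase k).erase i, ‖v k - v j‖ :=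
    Finset.prod_pos fun k _ => Finset.prod_pos fun j hj =>
      norm_pos_iff.mpr (sub_ne_zero.mpr
        (hinj.ne (Finset.ne_of_mem_erase (Finset.mem_of_mem_erase hj)).symm))
  rw [hsplit, hself] at hle
  exact (pow_le_pow_iff_left₀ (by positivity) (by positivity) two_ne_zero).mp
    (le_of_mul_le_mul_right hle hP)

/-- The growth of a Fekete polynomial off `K` controls that of all polynomials of smaller degree. -/
theorem norm_eval_mul_le_of_fekete {K : Set ℂ} {N : ℕ} {v : Fin N → ℂ} (hv : ∀ i, v i ∈ K)
    (hinj : Function.Injective v)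
    (hfek : ∀ i, ∀ x ∈ K, ∏ j ∈ Finset.univ.erase i, ‖x - v j‖
      ≤ ∏ j ∈ Finset.univ.erase i, ‖v i - v j‖)
    {D δ : ℝ} (hD : ∀ x ∈ K, ∀ y ∈ K, ‖x - y‖ ≤ D) (hδ : 0 < δ) {z : ℂ}
    (hz : ∀ x ∈ K, δ ≤ ‖z - x‖) {q : ℂ[X]} (hdeg : q.natDegree < N)
    (hq : ∀ x ∈ K, ‖q.eval x‖ ≤ 1) {x : ℂ} (hx : x ∈ K) :
    ‖q.eval z‖ * δ * ‖(Lagrange.nodal Finset.univ v).eval x‖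
      ≤ N * D * ‖(Lagrange.nodal Finset.univ v).eval z‖ := by
  classical
  set p := Lagrange.nodal Finset.univ v with hp
  have hzv : ∀ i ∈ Finset.univ, z ≠ v i := fun i _ h => by
    have := hz _ (hv i); simp [h] at this; linarith
  have hq' : q.eval z = p.eval z * ∑ i, Lagrange.nodalWeight Finset.univ v i * (z - v i)⁻¹ *
      q.eval (v i) := by
    conv_lhs => rw [Lagrange.eq_interpolate (s := Finset.univ) (v := v) (f := q) hinj.injOn
      (by simpa using degree_le_natDegree.trans_lt (by exact_mod_cast hdeg))]
    exact Lagrange.eval_interpolate_not_at_node _ hzv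
  -- Once the factor `x - v i` is split off `p(x)`, the Fekete property says that the remaining
  -- product is at most the denominator of the weight.
  have hw : ∀ i, ‖Lagrange.nodalWeight Finset.univ v i‖ * ‖p.eval x‖ ≤ D := by
    intro i
    have hpos : 0 < ∏ j ∈ Finset.univ.erase i, ‖v i - v j‖ := Finset.prod_pos fun j hj =>
      norm_pos_iff.mpr (sub_ne_zero.mpr (hinj.ne (Finset.ne_of_mem_erase hj).symm))
    rw [Lagrange.nodalWeight, norm_prod, hp, Lagrange.eval_nodal, norm_prod,
      ← Finset.mul_prod_erase _ _ (Finset.mem_univ i)]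
    simp only [norm_inv, Finset.prod_inv_distrib]
    rw [inv_mul_le_iff₀ hpos, mul_comm]
    have := norm_nonneg (x - v i)
    exact mul_le_mul (hfek i x hx) (hD x hx _ (hv i)) this hpos.le
  rw [hq', norm_mul]
  have hsum : ‖∑ i, Lagrange.nodalWeight Finset.univ v i * (z - v i)⁻¹ * q.eval (v i)‖ *
      (δ * ‖p.eval x‖) ≤ N * D := by
    calc _ ≤ (∑ i, ‖Lagrange.nodalWeight Finset.univ v i * (z - v i)⁻¹ * q.eval (v i)‖) *
          (δ * ‖p.eval x‖) := by gcongr; exact norm_sum_le _ _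
      _ = ∑ i, (‖Lagrange.nodalWeight Finset.univ v i‖ * ‖p.eval x‖) *
          (‖q.eval (v i)‖ * (δ / ‖z - v i‖)) := by
          rw [Finset.sum_mul]
          refine Finset.sum_congr rfl fun i _ => ?_
          rw [norm_mul, norm_mul, norm_inv]; ring
      _ ≤ ∑ _i : Fin N, D * (1 * 1) := by
          refine Finset.sum_le_sum fun i _ => ?_
          have h1 : δ / ‖z - v i‖ ≤ 1 :=
            div_le_one_of_le₀ (hz _ (hv i)) (norm_nonneg _)
          have h2 := hq _ (hv i)
          have h3 : 0 ≤ D := (norm_nonneg _).trans (hD x hx x hx)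
          exact mul_le_mul (hw i) (mul_le_mul h2 h1 (by positivity) zero_le_one)
            (by positivity) h3
      _ = N * D := by simp
  calc _ = ‖p.eval z‖ * (‖∑ i, Lagrange.nodalWeight Finset.univ v i * (z - v i)⁻¹ *
        q.eval (v i)‖ * (δ * ‖p.eval x‖)) := by ring
    _ ≤ ‖p.eval z‖ * (N * D) := by gcongr
    _ = _ := by ring

/-- A closed subset of the unbounded component of `ℂ ∖ K` is separated from the infinite compact
set `K` by a single polynomial. -/
theorem exists_monic_separating {K F : Set ℂ} (hK : IsCompact K) (hinf : K.Infinite)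
    (hF : IsClosed F) (hFK : F ⊆ unboundedComponent K) :
    ∃ p : ℂ[X], p.Monic ∧ 0 < p.natDegree ∧
      ∀ x ∈ K, ∀ z ∈ F, 2 * ‖p.eval x‖ ≤ ‖p.eval z‖ := by
  obtain ⟨Q, hQ1, hQ2⟩ := exists_finset_polynomial_separating hK hF hFK
  obtain ⟨D, hD0, hD⟩ : ∃ D : ℝ, 0 < D ∧ ∀ x ∈ K, ∀ y ∈ K, ‖x - y‖ ≤ D := by
    refine ⟨Metric.diam K + 1, by positivity, fun x hx y hy => ?_⟩
    rw [← dist_eq_norm]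
    linarith [Metric.dist_le_diam_of_mem hK.isBounded hx hy]
  have hdisj : Disjoint K F := Set.disjoint_right.mpr fun z hz => (hFK hz).1
  obtain ⟨δ, hδ, hsep⟩ : ∃ δ : ℝ, 0 < δ ∧ ∀ x ∈ K, ∀ z ∈ F, δ ≤ ‖z - x‖ := by
    obtain ⟨r, hr, h⟩ := Metric.exists_pos_forall_lt_edist hK hF hdisj
    refine ⟨r, by exact_mod_cast hr, fun x hx z hz => ?_⟩
    have := h x hx z hz
    rw [edist_nndist, ENNReal.coe_lt_coe] at this
    rw [← dist_eq_norm, dist_comm, ← coe_nndist]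
    exact_mod_cast this.le
  let B : ℕ := Q.sup natDegree
  obtain ⟨k, hk⟩ : ∃ k : ℕ, 2 * ((B * k + 1 : ℕ) : ℝ) * D ≤ (3 / 2 : ℝ) ^ k * δ := by
    have h1 : Filter.Tendsto (fun k : ℕ => (k : ℝ) ^ 1 / (3 / 2 : ℝ) ^ k) Filter.atTop (nhds 0) :=
      tendsto_pow_const_div_const_pow_of_one_lt 1 (by norm_num)
    have h0 : Filter.Tendsto (fun k : ℕ => (k : ℝ) ^ 0 / (3 / 2 : ℝ) ^ k) Filter.atTop (nhds 0) :=
      tendsto_pow_const_div_const_pow_of_one_lt 0 (by norm_num)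
    have h2 := (h1.const_mul (2 * B * D)).add (h0.const_mul (2 * D))
    rw [mul_zero, mul_zero, add_zero] at h2
    obtain ⟨k, hk⟩ := (h2.eventually (gt_mem_nhds hδ)).exists
    refine ⟨k, ?_⟩
    have h3 : (0 : ℝ) < (3 / 2) ^ k := by positivity
    have h4 : (2 * B * D * ((k : ℝ) ^ 1 / (3 / 2) ^ k) + 2 * D * ((k : ℝ) ^ 0 / (3 / 2) ^ k))
        * (3 / 2 : ℝ) ^ k = 2 * ((B * k + 1 : ℕ) : ℝ) * D := by
      push_cast; field_simp
    rw [← h4, mul_comm _ δ]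
    gcongr
  -- One node more than the largest possible degree of `q ^ k`: interpolation is exact for every `q
  -- ∈ Q`, with the same nodes.
  obtain ⟨v, hvK, hinj, hfek⟩ := exists_fekete_points hK hinf (B * k + 1)
  refine ⟨Lagrange.nodal Finset.univ v, Lagrange.nodal_monic, by simp [Lagrange.natDegree_nodal],
    fun x hx z hz => ?_⟩
  obtain ⟨q, hqQ, hqz⟩ := hQ2 z hz
  have hdeg : (q ^ k).natDegree < B * k + 1 := by
    have : q.natDegree ≤ B := Finset.le_sup hqQ
    calc (q ^ k).natDegree ≤ k * q.natDegree := natDegree_pow_le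
      _ ≤ k * B := by gcongr
      _ < B * k + 1 := by rw [mul_comm]; omega
  have key := norm_eval_mul_le_of_fekete hvK hinj hfek hD hδ (fun x hx => hsep x hx z hz) hdeg
    (fun x hx => by rw [eval_pow, norm_pow]; exact pow_le_one₀ (norm_nonneg _) (hQ1 q hqQ x hx)) hx
  rw [eval_pow, norm_pow] at key
  set a := ‖(Lagrange.nodal Finset.univ v).eval x‖
  have ha : 0 ≤ a := norm_nonneg _
  have hND : 0 < ((B * k + 1 : ℕ) : ℝ) * D := by positivity
  refine le_of_mul_le_mul_left ?_ hND
  calc ((B * k + 1 : ℕ) : ℝ) * D * (2 * a) = 2 * ((B * k + 1 : ℕ) : ℝ) * D * a := by ring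
    _ ≤ (3 / 2 : ℝ) ^ k * δ * a := by gcongr
    _ ≤ ‖q.eval z‖ ^ k * δ * a := by gcongr
    _ ≤ _ := key

/-! ### Upper bound for the capacity -/

/-- A Vandermonde determinant on `K` is controlled by the size on `K` of a monic polynomial. -/
theorem exists_vandermonde_bound {K : Set ℂ} (hK : IsCompact K) {p : ℂ[X]} (hp : p.Monic)
    (hd : 0 < p.natDegree) {r : ℝ} (hr : 0 < r) (hpK : ∀ x ∈ K, ‖p.eval x‖ ≤ r ^ p.natDegree) :
    ∃ C : ℝ, 1 ≤ C ∧ ∀ (n : ℕ) (v : Fin n → ℂ), (∀ i, v i ∈ K) →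
      ∏ i, ∏ j ∈ Finset.Ioi i, ‖v j - v i‖ ≤ n.factorial * (C ^ n * r ^ (∑ j : Fin n, (j : ℕ))) := by
  obtain ⟨R, hR1, hR⟩ : ∃ R : ℝ, 1 ≤ R ∧ ∀ x ∈ K, ‖x‖ ≤ R := by
    obtain ⟨R, hR⟩ := hK.exists_bound_of_continuousOn (f := fun x => x) (by fun_prop)
    exact ⟨max R 1, le_max_right _ _, fun x hx => (hR x hx).trans (le_max_left _ _)⟩
  set d := p.natDegree with hd'
  -- `s` compensates for the factor `r ^ (j % d)` when `r < 1`.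
  set s : ℝ := max 1 r⁻¹ with hs
  have hs1 : 1 ≤ s := le_max_left _ _
  have hsr : 1 ≤ s * r := by
    have : r⁻¹ ≤ s := le_max_right _ _
    rwa [inv_le_iff_one_le_mul₀ hr] at this
  -- A monic basis with one polynomial in each degree leaves the Vandermonde determinant unchanged,
  -- while `P j` has size about `r ^ j` on `K`.
  let P : ℕ → ℂ[X] := fun j => p ^ (j / d) * X ^ (j % d)
  have hPdeg : ∀ j, (P j).natDegree = j := fun j => by
    rw [(hp.pow _).natDegree_mul (monic_X_pow _), hp.natDegree_pow, natDegree_X_pow, ← hd']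
    exact Nat.div_add_mod' j d
  have hPmon : ∀ j, (P j).Monic := fun j => (hp.pow _).mul (monic_X_pow _)
  have hPb : ∀ j, ∀ x ∈ K, ‖(P j).eval x‖ ≤ (R ^ d * s ^ d) * r ^ j := by
    intro j x hx
    have hm : j % d ≤ d := (Nat.mod_lt _ hd).le
    have h1 : ‖(P j).eval x‖ ≤ (r ^ d) ^ (j / d) * R ^ (j % d) := by
      simp only [P, eval_mul, eval_pow, eval_X, norm_mul, norm_pow]
      gcongr
      · exact hpK x hx
      · exact hR x hx
    have h2 : R ^ (j % d) ≤ R ^ d := pow_le_pow_right₀ hR1 hm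
    have h3 : 1 ≤ s ^ d * r ^ (j % d) := by
      calc 1 ≤ (s * r) ^ (j % d) := one_le_pow₀ hsr
        _ = s ^ (j % d) * r ^ (j % d) := mul_pow _ _ _
        _ ≤ s ^ d * r ^ (j % d) := by gcongr
    calc ‖(P j).eval x‖ ≤ (r ^ d) ^ (j / d) * R ^ (j % d) := h1
      _ ≤ (r ^ d) ^ (j / d) * R ^ d * 1 := by rw [mul_one]; gcongr
      _ ≤ (r ^ d) ^ (j / d) * R ^ d * (s ^ d * r ^ (j % d)) := by gcongr
      _ = (R ^ d * s ^ d) * (r ^ (d * (j / d)) * r ^ (j % d)) := by rw [pow_mul]; ring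
      _ = _ := by rw [← pow_add, Nat.div_add_mod]
  refine ⟨R ^ d * s ^ d, one_le_mul_of_one_le_of_one_le (one_le_pow₀ hR1) (one_le_pow₀ hs1),
    fun n v hv => ?_⟩
  have hdet := Matrix.det_eval_matrixOfPolynomials_eq_det_vandermonde v (fun j : Fin n => P j)
    (fun j => hPdeg j) (fun j => hPmon j)
  have hlhs : ∏ i, ∏ j ∈ Finset.Ioi i, ‖v j - v i‖ = ‖(Matrix.vandermonde v).det‖ := by
    rw [Matrix.det_vandermonde, norm_prod]; simp_rw [norm_prod]
  rw [hlhs, hdet, Matrix.det_apply]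
  refine (norm_sum_le _ _).trans ?_
  calc _ ≤ ∑ _σ : Equiv.Perm (Fin n),
        ((R ^ d * s ^ d) ^ n * r ^ (∑ j : Fin n, (j : ℕ))) := by
        refine Finset.sum_le_sum fun σ _ => ?_
        have hsg : ‖Equiv.Perm.sign σ • ∏ i, Matrix.of (fun i j : Fin n => (P j).eval (v i)) (σ i) i‖
            = ∏ i : Fin n, ‖(P i).eval (v (σ i))‖ := by
          rcases Int.units_eq_one_or (Equiv.Perm.sign σ) with h | h <;> simp [h, norm_prod]
        rw [hsg]
        calc _ ≤ ∏ i : Fin n, ((R ^ d * s ^ d) * r ^ (i : ℕ)) :=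
              Finset.prod_le_prod (fun _ _ => norm_nonneg _) fun i _ => hPb i _ (hv _)
          _ = _ := by
              rw [Finset.prod_mul_distrib, Finset.prod_const, Finset.prod_pow_eq_pow_sum]; simp
    _ = _ := by simp [Fintype.card_perm]

theorem logKernel_of_ne {z t : ℂ} (h : z ≠ t) :
    logKernel z t = ((-Real.log ‖z - t‖ : ℝ) : EReal) := by
  have hpos : 0 < ‖z - t‖ := norm_pos_iff.mpr (sub_ne_zero.mpr h)
  rw [logKernel, ← ofReal_norm, ENNReal.log_ofReal_of_pos hpos, EReal.coe_neg]

theorem logKernel_self (z : ℂ) : logKernel z z = ⊤ := by simp [logKernel]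

theorem measurable_logKernel : Measurable fun w : ℂ × ℂ => logKernel w.1 w.2 := by
  unfold logKernel
  exact (Measurable.ennreal_log (by fun_prop)).neg

/-- A measure carried by a compact set has energy `+∞`, or its energy is the Bochner integral of
an integrable kernel. -/
theorem logEnergy_eq_top_or_integral {K : Set ℂ} (hK : IsCompact K) (μ : Measure ℂ)
    [IsProbabilityMeasure μ] (hμ : μ Kᶜ = 0) :
    logEnergy μ = ⊤ ∨ ((∀ᵐ w ∂μ.prod μ, w.1 ≠ w.2) ∧
      Integrable (fun w : ℂ × ℂ => -Real.log ‖w.1 - w.2‖) (μ.prod μ) ∧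
      logEnergy μ = ((∫ w, -Real.log ‖w.1 - w.2‖ ∂μ.prod μ : ℝ) : EReal)) := by
  set f : ℂ × ℂ → ℝ := fun w => -Real.log ‖w.1 - w.2‖ with hf
  have hfm : Measurable f := by fun_prop
  have hKae : ∀ᵐ x ∂μ, x ∈ K := hμ
  have hKK : ∀ᵐ w ∂μ.prod μ, w.1 ∈ K ∧ w.2 ∈ K :=
    (Measure.quasiMeasurePreserving_fst.ae hKae).and (Measure.quasiMeasurePreserving_snd.ae hKae)
  obtain ⟨D, hD0, hD⟩ : ∃ D : ℝ, 0 < D ∧ ∀ x ∈ K, ∀ y ∈ K, ‖x - y‖ ≤ D := by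
    refine ⟨Metric.diam K + 1, by positivity, fun x hx y hy => ?_⟩
    rw [← dist_eq_norm]
    linarith [Metric.dist_le_diam_of_mem hK.isBounded hx hy]
  have hneg : ∫⁻ w, (-logKernel w.1 w.2).toENNReal ∂μ.prod μ ≠ ⊤ := by
    refine ne_of_lt (lt_of_le_of_lt (lintegral_mono_ae (g := fun _ => ENNReal.ofReal D) ?_)
      (by simp))
    filter_upwards [hKK] with w hw
    by_cases h : w.1 = w.2
    · rw [h, logKernel_self]; simp
    · rw [logKernel_of_ne h, ← EReal.coe_neg, EReal.real_coe_toENNReal, neg_neg]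
      refine ENNReal.ofReal_le_ofReal ((Real.log_le_self (norm_nonneg _)).trans ?_)
      exact hD _ hw.1 _ hw.2
  by_cases hpos : ∫⁻ w, (logKernel w.1 w.2).toENNReal ∂μ.prod μ = ⊤
  · left
    rw [logEnergy, extendedIntegral, hpos]
    lift (∫⁻ w, (-logKernel w.1 w.2).toENNReal ∂μ.prod μ) to NNReal using hneg with b
    exact EReal.top_sub_coe b
  right
  -- Since `Real.log 0 = 0`, the real kernel is wrong on the diagonal; finite energy makes the
  -- diagonal null.
  have hoff : ∀ᵐ w ∂μ.prod μ, w.1 ≠ w.2 := by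
    filter_upwards [ae_lt_top measurable_logKernel.ereal_toENNReal hpos] with w hw h
    rw [h, logKernel_self] at hw
    simp at hw
  have hp : ∫⁻ w, (logKernel w.1 w.2).toENNReal ∂μ.prod μ
      = ∫⁻ w, ENNReal.ofReal (f w) ∂μ.prod μ := by
    refine lintegral_congr_ae ?_
    filter_upwards [hoff] with w hw
    rw [logKernel_of_ne hw, EReal.real_coe_toENNReal]
  have hn : ∫⁻ w, (-logKernel w.1 w.2).toENNReal ∂μ.prod μ
      = ∫⁻ w, ENNReal.ofReal (-f w) ∂μ.prod μ := by
    refine lintegral_congr_ae ?_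
    filter_upwards [hoff] with w hw
    rw [logKernel_of_ne hw, ← EReal.coe_neg, EReal.real_coe_toENNReal]
  have hint : Integrable f (μ.prod μ) := by
    refine ⟨hfm.aestronglyMeasurable, ?_⟩
    have habs : ∀ w, ‖f w‖ₑ ≤ ENNReal.ofReal (f w) + ENNReal.ofReal (-f w) := fun w => by
      rw [← ofReal_norm, Real.norm_eq_abs]
      rcases abs_cases (f w) with ⟨h, -⟩ | ⟨h, -⟩ <;> rw [h] <;> simp
    refine (lintegral_mono habs).trans_lt ?_
    rw [lintegral_add_left (by fun_prop), ← hp, ← hn]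
    exact ENNReal.add_lt_top.mpr ⟨lt_top_iff_ne_top.mpr hpos, lt_top_iff_ne_top.mpr hneg⟩
  refine ⟨hoff, hint, ?_⟩
  rw [integral_eq_lintegral_pos_part_sub_lintegral_neg_part hint, logEnergy, extendedIntegral,
    ← hp, ← hn]
  lift (∫⁻ w, (-logKernel w.1 w.2).toENNReal ∂μ.prod μ) to NNReal using hneg with b
  lift (∫⁻ w, (logKernel w.1 w.2).toENNReal ∂μ.prod μ) to NNReal using hpos with a
  rfl

/-- The law of two coordinates of an independent sample. -/
theorem map_pi_pair {n : ℕ} (μ : Measure ℂ) [IsProbabilityMeasure μ] {i j : Fin n} (h : i ≠ j) :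
    (Measure.pi fun _ : Fin n => μ).map (fun x => (x i, x j)) = μ.prod μ := by
  have hind := (ProbabilityTheory.iIndepFun_pi (μ := fun _ : Fin n => μ)
    (X := fun _ => (id : ℂ → ℂ)) (fun _ => aemeasurable_id)).indepFun h
  have := (ProbabilityTheory.indepFun_iff_map_prod_eq_prod_map_map
    (measurable_pi_apply i).aemeasurable (measurable_pi_apply j).aemeasurable).mp hind
  change Measure.map (fun x : Fin n → ℂ => (x i, x j)) _ =
    (Measure.map (fun x : Fin n → ℂ => x i) _).prod (Measure.map (fun x : Fin n → ℂ => x j) _) at this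
  rw [this]
  have he : ∀ k : Fin n, (Measure.pi fun _ : Fin n => μ).map (fun x => x k) = μ := fun k =>
    (measurePreserving_eval (fun _ : Fin n => μ) k).map_eq
  rw [he, he]

/-- The energy is bounded below in terms of the discrete energies of `n` points. -/
theorem le_integral_of_vandermonde_bound {K : Set ℂ} (μ : Measure ℂ) [IsProbabilityMeasure μ]
    (hμ : μ Kᶜ = 0) (hoff : ∀ᵐ w ∂μ.prod μ, w.1 ≠ w.2)
    (hint : Integrable (fun w : ℂ × ℂ => -Real.log ‖w.1 - w.2‖) (μ.prod μ)) {n : ℕ} {B : ℝ}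
    (hB : ∀ v : Fin n → ℂ, (∀ i, v i ∈ K) → ∏ i, ∏ j ∈ Finset.Ioi i, ‖v j - v i‖ ≤ B) :
    -Real.log B ≤ (∑ j : Fin n, (j : ℕ)) * ∫ w, -Real.log ‖w.1 - w.2‖ ∂μ.prod μ := by
  set f : ℂ × ℂ → ℝ := fun w => -Real.log ‖w.1 - w.2‖ with hf
  have hfm : Measurable f := by fun_prop
  let P := Measure.pi fun _ : Fin n => μ
  have hmp : ∀ i j : Fin n, j ≠ i → MeasurePreserving (fun x : Fin n → ℂ => (x j, x i)) P
      (μ.prod μ) := fun i j h => ⟨by fun_prop, map_pi_pair μ h⟩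
  have hKae : ∀ᵐ x ∂P, ∀ i, x i ∈ K := ae_all_iff.mpr fun i =>
    (measurePreserving_eval (fun _ : Fin n => μ) i).quasiMeasurePreserving.ae
      (show ∀ᵐ x ∂μ, x ∈ K from hμ)
  have hoffae : ∀ᵐ x ∂P, ∀ i j : Fin n, j ≠ i → x j ≠ x i :=
    ae_all_iff.mpr fun i => ae_all_iff.mpr fun j => by
      by_cases h : j = i
      · simp [h]
      · filter_upwards [(hmp i j h).quasiMeasurePreserving.ae hoff] with x hx _ using hx
  have hI : ∀ i : Fin n, ∀ j ∈ Finset.Ioi i, Integrable (fun x : Fin n → ℂ => f (x j, x i)) P :=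
    fun i j hj => (hmp i j (Finset.mem_Ioi.mp hj).ne').integrable_comp_of_integrable hint
  have hval : ∀ i : Fin n, ∀ j ∈ Finset.Ioi i, ∫ x, f (x j, x i) ∂P = ∫ w, f w ∂μ.prod μ := by
    intro i j hj
    have h := hmp i j (Finset.mem_Ioi.mp hj).ne'
    rw [← h.map_eq, integral_map h.measurable.aemeasurable hfm.aestronglyMeasurable]
  -- Each of the `n(n-1)/2` pairs of an independent sample has expected energy `I(μ)`.
  have hsum : ∫ x, ∑ i, ∑ j ∈ Finset.Ioi i, f (x j, x i) ∂P
      = (∑ j : Fin n, (j : ℕ)) * ∫ w, f w ∂μ.prod μ := by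
    rw [integral_finsetSum _ fun i _ => integrable_finsetSum _ (hI i)]
    have : ∀ i : Fin n, ∫ x, ∑ j ∈ Finset.Ioi i, f (x j, x i) ∂P
        = ((n - 1 - i : ℕ) : ℝ) * ∫ w, f w ∂μ.prod μ := fun i => by
      rw [integral_finsetSum _ (hI i), Finset.sum_congr rfl (hval i), Finset.sum_const,
        Fin.card_Ioi, nsmul_eq_mul]
    rw [Finset.sum_congr rfl fun i _ => this i, ← Finset.sum_mul]
    congr 1
    rw [Fin.sum_univ_eq_sum_range (fun i => ((n - 1 - i : ℕ) : ℝ)),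
      Fin.sum_univ_eq_sum_range (fun i => i),
      Finset.sum_range_reflect (fun i => (i : ℝ)) n]
    push_cast; rfl
  rw [← hsum]
  have hae : ∀ᵐ x ∂P, -Real.log B ≤ ∑ i, ∑ j ∈ Finset.Ioi i, f (x j, x i) := by
    filter_upwards [hKae, hoffae] with x hxK hx
    have hne : ∀ i : Fin n, ∀ j ∈ Finset.Ioi i, ‖x j - x i‖ ≠ 0 := fun i j hj =>
      norm_ne_zero_iff.mpr (sub_ne_zero.mpr (hx i j (Finset.mem_Ioi.mp hj).ne'))
    have hprod : 0 < ∏ i, ∏ j ∈ Finset.Ioi i, ‖x j - x i‖ := Finset.prod_pos fun i _ =>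
      Finset.prod_pos fun j hj => (norm_nonneg _).lt_of_ne' (hne i j hj)
    have hlog : Real.log (∏ i, ∏ j ∈ Finset.Ioi i, ‖x j - x i‖)
        = ∑ i, ∑ j ∈ Finset.Ioi i, Real.log ‖x j - x i‖ := by
      rw [Real.log_prod fun i _ => Finset.prod_ne_zero_iff.mpr (hne i)]
      exact Finset.sum_congr rfl fun i _ => Real.log_prod (hne i)
    have := Real.log_le_log hprod (hB x hxK)
    rw [hlog] at this
    simpa [hf, Finset.sum_neg_distrib] using this
  have := integral_mono_ae (integrable_const (-Real.log B))
    (integrable_finsetSum _ fun i _ => integrable_finsetSum _ (hI i)) hae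
  simpa using this

/-- The capacity of a compact set on which a monic polynomial `p` of degree `d` satisfies
`|p| ≤ r ^ d` is at most `r`. -/
theorem logCapacity_le_of_norm_eval_le {K : Set ℂ} (hK : IsCompact K) {p : ℂ[X]} (hp : p.Monic)
    (hd : 0 < p.natDegree) {r : ℝ} (hr : 0 < r) (hpK : ∀ x ∈ K, ‖p.eval x‖ ≤ r ^ p.natDegree) :
    logCapacity K ≤ ENNReal.ofReal r := by
  suffices h : ((-Real.log r : ℝ) : EReal) ≤ robinConstant K by
    rw [logCapacity, ← Real.exp_log hr, ← EReal.exp_coe, EReal.exp_le_exp_iff]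
    rw [EReal.coe_neg] at h
    exact EReal.neg_le_of_neg_le h
  refine le_iInf₂ fun μ hμ => ?_
  rcases logEnergy_eq_top_or_integral hK (μ : Measure ℂ) hμ with h | ⟨hoff, hint, h⟩
  · rw [h]; exact le_top
  rw [h, EReal.coe_le_coe_iff]
  set I := ∫ w, -Real.log ‖w.1 - w.2‖ ∂(μ : Measure ℂ).prod μ
  obtain ⟨C, hC1, hC⟩ := exists_vandermonde_bound hK hp hd hr hpK
  by_contra! hlt
  set e := -Real.log r - I
  have he : 0 < e := sub_pos.mpr hlt
  have hC0 : 0 ≤ Real.log C := Real.log_nonneg hC1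
  -- With `n = m ^ 2` points, the crude `log m ≤ m` suffices: `log n!` is at most `2 m ^ 3`, against
  -- about `m ^ 4 / 2` pairs.
  have key : ∀ m : ℕ, 1 ≤ m → e * m ≤ 4 + 2 * Real.log C + e := by
    intro m hm
    have hm' : (1 : ℝ) ≤ m := by exact_mod_cast hm
    have hb := le_integral_of_vandermonde_bound (μ : Measure ℂ) hμ hoff hint (hC (m ^ 2))
    have hC' : C ≠ 0 := by linarith
    have hfac : Real.log ((m ^ 2).factorial : ℝ) ≤ m ^ 2 * (2 * m) := by
      calc Real.log ((m ^ 2).factorial : ℝ) ≤ Real.log (((m ^ 2 : ℕ) : ℝ) ^ (m ^ 2)) := by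
            refine Real.log_le_log (by positivity) ?_
            exact_mod_cast Nat.factorial_le_pow (m ^ 2)
        _ = m ^ 2 * (2 * Real.log m) := by
            rw [Real.log_pow]; push_cast; rw [Real.log_pow]; push_cast; ring
        _ ≤ m ^ 2 * (2 * m) := by gcongr; exact Real.log_le_self (by positivity)
    rw [Real.log_mul (by positivity) (by positivity), Real.log_mul (by positivity) (by positivity),
      Real.log_pow, Real.log_pow] at hb
    have hs : ((∑ j : Fin (m ^ 2), (j : ℕ) : ℕ) : ℝ) * 2 = m ^ 2 * (m ^ 2 - 1) := by
      rw [Fin.sum_univ_eq_sum_range (fun i => i)]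
      have := Finset.sum_range_id_mul_two (m ^ 2)
      have h1 : 1 ≤ m ^ 2 := Nat.one_le_pow _ _ hm
      calc _ = (((∑ i ∈ Finset.range (m ^ 2), i) * 2 : ℕ) : ℝ) := by push_cast; ring
        _ = _ := by rw [this]; push_cast [Nat.cast_sub h1]; ring
    set s := ((∑ j : Fin (m ^ 2), (j : ℕ) : ℕ) : ℝ)
    have h1 : e * s ≤ m ^ 2 * (2 * m) + m ^ 2 * Real.log C := by
      simp only [e]
      push_cast at hb
      linarith
    have h2 : (m : ℝ) ^ 2 * (e * (m ^ 2 - 1)) ≤ m ^ 2 * (4 * m + 2 * Real.log C) := by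
      have : (m : ℝ) ^ 2 * (e * (m ^ 2 - 1)) = e * s * 2 := by rw [mul_assoc, hs]; ring
      rw [this]; linarith
    have h3 := le_of_mul_le_mul_left h2 (by positivity)
    have h4 : m * (e * m) ≤ m * (4 + 2 * Real.log C + e) := by nlinarith
    exact le_of_mul_le_mul_left h4 (by positivity)
  obtain ⟨m, hm⟩ := exists_nat_gt ((4 + 2 * Real.log C + e) / e)
  rw [div_lt_iff₀ he] at hm
  have h0 : 1 ≤ m := by
    rcases Nat.eq_zero_or_pos m with rfl | h
    · exfalso; simp at hm; linarith
    · exact h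
  linarith [key m h0]

/-! ### Hilbert's theorem -/

/-- A monic polynomial vanishing on a finite set bounds its capacity by every `ε > 0`. The extra
factor `X` keeps the degree positive when the set is empty. -/
theorem infinite_of_logCapacity_pos {K : Set ℂ} (hcap : 0 < logCapacity K) : K.Infinite := by
  intro hfin
  have hp : (X * ∏ a ∈ hfin.toFinset, (X - C a)).Monic :=
    monic_X.mul (monic_prod_of_monic _ _ fun a _ => monic_X_sub_C a)
  have hd : 0 < (X * ∏ a ∈ hfin.toFinset, (X - C a)).natDegree := by
    rw [monic_X.natDegree_mul (monic_prod_of_monic _ _ fun a _ => monic_X_sub_C a), natDegree_X]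
    omega
  have hz : ∀ x ∈ K, (X * ∏ a ∈ hfin.toFinset, (X - C a)).eval x = 0 := fun x hx => by
    rw [eval_mul, eval_prod, Finset.prod_eq_zero (hfin.mem_toFinset.mpr hx) (by simp), mul_zero]
  refine hcap.not_ge (ENNReal.le_of_forall_pos_le_add fun ε hε _ => ?_)
  have := logCapacity_le_of_norm_eval_le hfin.isCompact hp hd (r := ε) (by exact_mod_cast hε)
    (fun x hx => by rw [hz x hx, norm_zero]; positivity)
  simpa using this

/-- A connected set missing `K` lies in one component of `Kᶜ`, so meeting the unbounded one is
enough. -/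
theorem compl_subset_unboundedComponent {K U : Set ℂ} (hKU : K ⊆ U) (hconn : IsPreconnected Uᶜ)
    (hout : U = Set.univ ∨ (Uᶜ ∩ unboundedComponent K).Nonempty) :
    Uᶜ ⊆ unboundedComponent K := by
  rcases hout with rfl | ⟨w, hwU, -, hw⟩
  · simp
  intro z hz
  have hsub : Uᶜ ⊆ Kᶜ := Set.compl_subset_compl.mpr hKU
  refine ⟨hsub hz, ?_⟩
  rwa [← connectedComponentIn_eq (hconn.subset_connectedComponentIn hwU hsub hz)]

theorem theorem3 (K U : Set ℂ) (hK : IsCompact K) (hcap : 0 < logCapacity K)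
    (hU : IsOpen U) (hKU : K ⊆ U) (hconn : IsPreconnected Uᶜ)
    (hout : U = Set.univ ∨ (Uᶜ ∩ unboundedComponent K).Nonempty) :
    ∃ (p : ℂ[X]) (ρ : ℝ), p.Monic ∧ 0 < p.natDegree ∧ logCapacity K < ENNReal.ofReal ρ ∧
      K ⊆ lemniscate p ρ ∧ lemniscate p ρ ⊆ U := by
  have hinf := infinite_of_logCapacity_pos hcap
  obtain ⟨p, hp, hd, hsep⟩ := exists_monic_separating hK hinf hU.isClosed_compl
    (compl_subset_unboundedComponent hKU hconn hout)
  obtain ⟨x, hxK, hmax⟩ := hK.exists_isMaxOn hinf.nonempty p.continuous.norm.continuousOn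
  set M := ‖p.eval x‖
  have hle : ∀ y ∈ K, ‖p.eval y‖ ≤ M := fun y hy => hmax hy
  -- Otherwise the infinite set `K` would consist of roots of `p`.
  have hM : 0 < M := by
    refine (norm_nonneg _).lt_of_ne' fun h0 => hinf ?_
    refine (p.roots.toFinset.finite_toSet).subset fun y hy => ?_
    have : ‖p.eval y‖ = 0 := le_antisymm ((hle y hy).trans h0.le) (norm_nonneg _)
    simpa [hp.ne_zero] using this
  have hroot : ∀ a : ℝ, 0 ≤ a → (a ^ ((p.natDegree : ℝ)⁻¹)) ^ p.natDegree = a := fun a ha =>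
    Real.rpow_inv_natCast_pow ha hd.ne'
  -- Any level strictly between `M` and `2M` would do: above `M` for the strict capacity bound,
  -- below `2M` to exclude `Uᶜ`.
  refine ⟨p, (3 / 2 * M) ^ ((p.natDegree : ℝ)⁻¹), hp, hd, ?_, fun y hy => ?_, fun z hz => ?_⟩
  · refine (logCapacity_le_of_norm_eval_le hK hp hd (r := M ^ ((p.natDegree : ℝ)⁻¹))
      (by positivity) fun y hy => by rw [hroot M hM.le]; exact hle y hy).trans_lt ?_
    rw [ENNReal.ofReal_lt_ofReal_iff (by positivity)]
    exact Real.rpow_lt_rpow hM.le (by linarith) (by positivity)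
  · change ‖p.eval y‖ ≤ _
    rw [hroot _ (by positivity)]
    linarith [hle y hy]
  · by_contra hzU
    have h1 : ‖p.eval z‖ ≤ _ := hz
    rw [hroot _ (by positivity)] at h1
    linarith [hsep x hxK z hzU]
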